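/- All graphs are finite, simple and undirected. A leaf of a tree is a vertex of degree $1$. For a graph $G$ and an integer $k\ge 0$, a (finite) tree $T$ is a $k$-leaf root of $G$ if the set of leaves of $T$ equals the vertex set $V(G)$ and any two distinct vertices $u,v$ of $G$ are adjacent in $G$ if and only if $\mathrm{dist}_T(u,v)\le k$. The leaf rank of $G$ is the smallest integer $k\ge 0$ such that $G$ has a $k$-leaf root; if there is no such $k$, then $G$ has infinite leaf rank. Theorem. Let $n$ be a non-negative integer. Every graph $G$ of order $n$ (that is, with $|V(G)|=n$) has either infinite leaf rank or leaf rank at most $2n\cdot 2^{2n}$. -/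

import Mathlib

namespace LeafRank

/-- A leaf of a tree is a vertex of degree one, that is, with exactly one neighbour. -/
def IsLeaf {W : Type*} (T : SimpleGraph W) (w : W) : Prop :=
  (T.neighborSet w).ncard = 1

/-- The tree `T`, with the vertices of `G` identified with vertices of `T` by `f`, is a
`k`-leaf root of `G`: the leaves of `T` are exactly the vertices of `G`, and distinct vertices
of `G` are adjacent if and only if their distance in `T` is at most `k`. -/
structure IsLeafRoot {V W : Type*} (G : SimpleGraph V) (T : SimpleGraph W) (f : V ↪ W)
    (k : ℕ) : Prop where
  isTree : T.IsTree
  leaves_eq : {w | IsLeaf T w} = Set.range f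
  adj_iff : ∀ u v : V, u ≠ v → (G.Adj u v ↔ T.dist (f u) (f v) ≤ k)

/-- `G` has a `k`-leaf root. Trees are finite, so that vertex types in `Type` suffice. -/
def HasLeafRoot {V : Type*} (G : SimpleGraph V) (k : ℕ) : Prop :=
  ∃ (W : Type) (_ : Finite W) (T : SimpleGraph W) (f : V ↪ W), IsLeafRoot G T f k

/-- The leaf rank of `G`: the least `k` such that `G` has a `k`-leaf root, and `⊤` (infinite)
if there is no such `k`. -/
noncomputable def leafRank {V : Type*} (G : SimpleGraph V) : ℕ∞ :=
  ⨅ (k : ℕ) (_ : HasLeafRoot G k), (k : ℕ∞)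

end LeafRank

open Matrix

/-! Root a leaf root at one of its leaves. Adjacency then depends only on the depths of the other
leaves, the depths at which their branches part, and the threshold. Branching depths form an
ultrametric, so $n-1$ leaves have at most $n-2$ distinct ones (`card_image_offDiag_add_one_le`).
Hence at most $2n-3$ unknowns and the threshold satisfy a finite linear system with right-hand sides
0 or 1 that records the order of the depths, all adjacencies and all non-adjacencies.

Conversely, any positive integer solution yields a leaf root of the same graph
(`IsBranchDepth.exists_tree`). A basic solution, scaled by its determinant, is integral by Cramer's
rule (`exists_integer_solution`). Its threshold is a determinant whose other columns have rows that
are sums of two differences of basis vectors (or zero). Multilinearity and total unimodularity bound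
it by $(m+1)2^m$ for $m$ unknowns besides the threshold. -/

/-! ### Determinants of matrices with rows built from differences of basis vectors. -/

/-- The standard basis vectors, extended by zero at `none`. -/
def optionBasis {m : ℕ} (o : Option (Fin m)) (j : Fin m) : ℤ :=
  if o = some j then 1 else 0

lemma optionBasis_comp_succAbove {m : ℕ} (o : Option (Fin (m + 1))) (c : Fin (m + 1)) :
    ∃ o' : Option (Fin m), ∀ j, optionBasis o (c.succAbove j) = optionBasis o' j := by
  by_cases h : ∃ j, o = some (c.succAbove j)
  · obtain ⟨j, rfl⟩ := h
    exact ⟨some j, fun i => by simp [optionBasis]⟩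
  · push Not at h
    exact ⟨none, fun i => by simp [optionBasis, h]⟩

lemma abs_det_optionBasis_sub_le_one {m : ℕ} (p q : Fin m → Option (Fin m)) :
    |(Matrix.of fun i j => optionBasis (p i) j - optionBasis (q i) j).det| ≤ 1 := by
  induction m with
  | zero => simp
  | succ m ih =>
    -- If all rows sum to zero, the all-ones vector lies in the kernel. Otherwise some row has a
    -- single nonzero entry, which is ±1, and Laplace expansion along it leaves a minor of the same
    -- kind.
    by_cases h : ∀ i, p i = none ↔ q i = none
    · have h0 : (Matrix.of fun i j => optionBasis (p i) j - optionBasis (q i) j).det = 0 := by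
        rw [← Matrix.exists_mulVec_eq_zero_iff]
        refine ⟨fun _ => 1, fun h => one_ne_zero (congrFun h 0), ?_⟩
        ext i
        have hi := h i
        simp only [mulVec, dotProduct, of_apply, optionBasis, mul_one, Pi.zero_apply]
        revert hi
        rcases p i with _ | a <;> rcases q i with _ | b <;> simp
      simp [h0]
    · push Not at h
      obtain ⟨i, hi⟩ := h
      obtain ⟨c, ε, hε, hrow⟩ : ∃ (c : Fin (m + 1)) (ε : ℤ), |ε| = 1 ∧
          ∀ j, optionBasis (p i) j - optionBasis (q i) j = if j = c then ε else 0 := by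
        rcases hp : p i with _ | a <;> rcases hq : q i with _ | b <;> simp_all
        · refine ⟨b, -1, by simp, fun j => ?_⟩
          simp [optionBasis, eq_comm]; split_ifs <;> simp
        · refine ⟨a, 1, by simp, fun j => ?_⟩
          simp [optionBasis, eq_comm]
      rw [Matrix.det_succ_row _ i, Finset.sum_eq_single c]
      · choose p' hp' using fun i' => optionBasis_comp_succAbove (p (i.succAbove i')) c
        choose q' hq' using fun i' => optionBasis_comp_succAbove (q (i.succAbove i')) c
        have := ih p' q'
        simp only [of_apply, hrow, if_true, abs_mul, abs_pow, abs_neg, abs_one, one_pow, one_mul,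
          hε]
        refine (congrArg (fun M => |det M|) ?_).trans_le this
        ext a b
        simp [hp', hq']
      · intro j _ hj
        simp [hrow, hj]
      · simp

/-- Multilinearity in the rows splits the determinant into $2^m$ determinants of difference
matrices, each at most 1 in absolute value. -/
lemma abs_det_optionBasis_add_le {m : ℕ} (p q p' q' : Fin m → Option (Fin m)) :
    |(Matrix.of fun i j => (optionBasis (p i) j - optionBasis (q i) j) +
      (optionBasis (p' i) j - optionBasis (q' i) j)).det| ≤ 2 ^ m := by
  have := (Matrix.detRowAlternating (R := ℤ) (n := Fin m)).toMultilinearMap.map_add_univ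
    (fun i j => optionBasis (p i) j - optionBasis (q i) j)
    (fun i j => optionBasis (p' i) j - optionBasis (q' i) j)
  change Matrix.det _ = ∑ s : Finset (Fin m), Matrix.det _ at this
  have h2 : (Matrix.of fun i j => (optionBasis (p i) j - optionBasis (q i) j) +
      (optionBasis (p' i) j - optionBasis (q' i) j)).det = _ := this
  rw [h2]
  calc _ ≤ ∑ s : Finset (Fin m), (1 : ℤ) := by
        refine (Finset.abs_sum_le_sum_abs _ _).trans (Finset.sum_le_sum fun s _ => ?_)
        refine (congrArg (fun M => |det M|) ?_).trans_le (abs_det_optionBasis_sub_le_one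
          (fun i => if i ∈ s then p i else p' i) (fun i => if i ∈ s then q i else q' i))
        ext i j
        by_cases hi : i ∈ s <;> simp [Finset.piecewise, hi]
    _ = 2 ^ m := by simp

/-- Column 0, the only one of unrestricted shape, is replaced by `b`. Expansion along it gives $m+1$
minors, each at most $2^m$. -/
lemma abs_cramer_zero_le {m : ℕ} (A : Matrix (Fin (m + 1)) (Fin (m + 1)) ℤ) (b : Fin (m + 1) → ℤ)
    (hb : ∀ i, |b i| ≤ 1) (p q p' q' : Fin (m + 1) → Option (Fin m))
    (hA : ∀ i j, A i j.succ = (optionBasis (p i) j - optionBasis (q i) j) +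
      (optionBasis (p' i) j - optionBasis (q' i) j)) :
    |A.cramer b 0| ≤ (m + 1) * 2 ^ m := by
  rw [Matrix.cramer_apply, Matrix.det_succ_column_zero]
  calc _ ≤ ∑ i : Fin (m + 1), (2 : ℤ) ^ m := by
        refine (Finset.abs_sum_le_sum_abs _ _).trans (Finset.sum_le_sum fun i _ => ?_)
        have := abs_det_optionBasis_add_le (fun k => p (i.succAbove k)) (fun k => q (i.succAbove k))
          (fun k => p' (i.succAbove k)) (fun k => q' (i.succAbove k))
        simp only [abs_mul, abs_pow, abs_neg, abs_one, one_pow, one_mul, updateCol_self]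
        refine (mul_le_of_le_one_left (abs_nonneg _) (hb i)).trans ?_
        refine (congrArg (fun M => |det M|) ?_).trans_le this
        ext k j
        simp [hA]
    _ = _ := by simp

/-! ### Small integer solutions of linear systems. -/

/-- A feasible system of linear inequalities whose rows separate points has a basic solution. -/
lemma exists_basic_solution {ι : Type*} [Finite ι] {n : ℕ} (a : ι → Fin n → ℚ) (b : ι → ℚ)
    (ha : ∀ d : Fin n → ℚ, (∀ i, a i ⬝ᵥ d = 0) → d = 0)
    (hx : ∃ x, ∀ i, b i ≤ a i ⬝ᵥ x) :
    ∃ x, (∀ i, b i ≤ a i ⬝ᵥ x) ∧ ∃ s : Fin n → ι, (∀ j, a (s j) ⬝ᵥ x = b (s j)) ∧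
      LinearIndependent ℚ (fun j => a (s j)) := by
  cases nonempty_fintype ι
  suffices H : ∀ k ≤ n, ∃ x, (∀ i, b i ≤ a i ⬝ᵥ x) ∧ ∃ s : Fin k → ι,
      (∀ j, a (s j) ⬝ᵥ x = b (s j)) ∧ LinearIndependent ℚ (fun j => a (s j)) from H n le_rfl
  intro k
  induction k with
  | zero =>
    obtain ⟨x, hx⟩ := hx
    exact fun _ => ⟨x, hx, Fin.elim0, fun j => j.elim0, linearIndependent_empty_type⟩
  | succ k ih =>
    intro hk
    obtain ⟨x, hx, s, hs, hli⟩ := ih (by omega)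
    obtain ⟨d, hd, hd0⟩ : ∃ d : Fin n → ℚ, (∀ j, a (s j) ⬝ᵥ d = 0) ∧ d ≠ 0 := by
      have h := LinearMap.ker_ne_bot_of_finrank_lt
        (f := Matrix.mulVecLin (Matrix.of fun j => a (s j))) (by simpa using hk)
      obtain ⟨d, hd, hd0⟩ := (Submodule.ne_bot_iff _).1 h
      exact ⟨d, fun j => congrFun (LinearMap.mem_ker.1 hd) j, hd0⟩
    -- Since the rows separate points, some constraint decreases along `d` or along `-d`.
    obtain ⟨d, hd, i, hi⟩ : ∃ d : Fin n → ℚ, (∀ j, a (s j) ⬝ᵥ d = 0) ∧ ∃ i, a i ⬝ᵥ d < 0 := by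
      by_contra! hcon
      refine hd0 (ha d fun i => le_antisymm ?_ (hcon d hd i))
      have := hcon (-d) (fun j => by simp [hd]) i
      simpa using this
    -- Ratio test: `i₀` is the first constraint to become tight when moving along `d`. Its row is
    -- independent of the earlier ones, which all annihilate `d`.
    obtain ⟨i₀, hi₀, hmin⟩ := Finset.exists_min_image
      (Finset.univ.filter fun i => a i ⬝ᵥ d < 0)
      (fun i => (a i ⬝ᵥ x - b i) / (-(a i ⬝ᵥ d))) ⟨i, by simpa using hi⟩
    simp only [Finset.mem_filter, Finset.mem_univ, true_and] at hi₀ hmin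
    set t := (a i₀ ⬝ᵥ x - b i₀) / (-(a i₀ ⬝ᵥ d)) with ht
    have ht0 : 0 ≤ t := div_nonneg (by linarith [hx i₀]) (by linarith)
    refine ⟨x + t • d, fun i => ?_, Fin.snoc s i₀, fun j => ?_, ?_⟩
    · rw [dotProduct_add, dotProduct_smul, smul_eq_mul]
      rcases lt_or_ge (a i ⬝ᵥ d) 0 with h | h
      · have := (le_div_iff₀ (by linarith)).1 (hmin i h)
        linarith
      · have := mul_nonneg ht0 h
        linarith [hx i]
    · rw [dotProduct_add, dotProduct_smul, smul_eq_mul]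
      refine Fin.lastCases ?_ (fun j => ?_) j
      · simp only [Fin.snoc_last]
        rw [ht]
        field_simp [hi₀.ne]
        ring
      · simp [hd, hs]
    · have : (fun j => a ((Fin.snoc s i₀ : Fin (k + 1) → ι) j)) =
          Fin.snoc (fun j => a (s j)) (a i₀) := by
        ext j : 1
        refine Fin.lastCases ?_ (fun j => ?_) j <;> simp
      rw [this, linearIndependent_finSnoc]
      refine ⟨hli, fun hmem => hi₀.ne ?_⟩
      refine Submodule.span_induction (p := fun v _ => v ⬝ᵥ d = 0) ?_ (by simp) ?_ ?_ hmem
      · rintro _ ⟨j, rfl⟩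
        exact hd j
      · intro u v _ _ hu hv
        rw [add_dotProduct, hu, hv, add_zero]
      · intro c v _ hv
        rw [smul_dotProduct, hv, smul_zero]

lemma exists_integer_solution {ι : Type*} [Finite ι] {m : ℕ} (a : ι → Fin (m + 1) → ℤ)
    (b : ι → ℤ) (hb0 : ∀ i, 0 ≤ b i) (hb1 : ∀ i, b i ≤ 1)
    (hrow : ∀ i, ∃ p q p' q' : Option (Fin m), ∀ j : Fin m, a i j.succ =
      (optionBasis p j - optionBasis q j) + (optionBasis p' j - optionBasis q' j))
    (hunit : ∀ j, ∃ i, a i = Pi.single j 1) (hx : ∃ x, ∀ i, b i ≤ a i ⬝ᵥ x) :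
    ∃ z, (∀ i, b i ≤ a i ⬝ᵥ z) ∧ z 0 ≤ (m + 1) * 2 ^ m := by
  have cast_dot (u v : Fin (m + 1) → ℤ) :
      ((u ⬝ᵥ v : ℤ) : ℚ) = (fun j => (u j : ℚ)) ⬝ᵥ (fun j => (v j : ℚ)) := by
    simp [dotProduct]
  obtain ⟨x, hx, s, hs, hli⟩ := exists_basic_solution (fun i j => (a i j : ℚ)) (fun i => (b i : ℚ))
    (by
      intro d hd
      ext j
      obtain ⟨i, hi⟩ := hunit j
      have := hd i
      rw [hi] at this
      have h2 : (fun k => ((Pi.single j 1 : Fin (m + 1) → ℤ) k : ℚ)) = Pi.single j 1 := by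
        ext k
        by_cases hk : k = j
        · subst hk; simp
        · simp [hk]
      simpa [h2] using this)
    (by
      obtain ⟨x, hx⟩ := hx
      refine ⟨fun j => (x j : ℚ), fun i => ?_⟩
      rw [← cast_dot]
      exact_mod_cast hx i)
  set A : Matrix (Fin (m + 1)) (Fin (m + 1)) ℤ := Matrix.of fun j => a (s j) with hA
  set B : Fin (m + 1) → ℤ := fun j => b (s j) with hB
  set Aq : Matrix (Fin (m + 1)) (Fin (m + 1)) ℚ := A.map (Int.cast) with hAq
  have hdetq : Aq.det = (A.det : ℚ) := by
    rw [hAq]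
    exact (RingHom.map_det (Int.castRingHom ℚ) A).symm
  have hdet : A.det ≠ 0 := by
    have h1 : IsUnit Aq := Matrix.linearIndependent_rows_iff_isUnit.1 hli
    rw [Matrix.isUnit_iff_isUnit_det, hdetq] at h1
    exact_mod_cast h1.ne_zero
  have hcr : ∀ j, ((A.cramer B j : ℤ) : ℚ) = (A.det : ℚ) * x j := by
    have h1 : Aq *ᵥ x = fun j => (B j : ℚ) := funext hs
    have h2 : Aq *ᵥ (fun j => ((A.cramer B j : ℤ) : ℚ)) = Aq *ᵥ ((A.det : ℚ) • x) := by
      rw [Matrix.mulVec_smul, h1]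
      ext i
      have := congrFun (A.mulVec_cramer B) i
      have h3 := congrArg (Int.cast : ℤ → ℚ) this
      simp only [Matrix.mulVec, cast_dot] at h3
      simpa [Matrix.mulVec, hAq] using h3
    have h3 := Matrix.mulVec_injective_of_isUnit
      (Matrix.linearIndependent_rows_iff_isUnit.1 hli : IsUnit Aq) h2
    exact fun j => congrFun h3 j
  -- By Cramer's rule this is $|\det A|\,x$. Scaling by a factor at least 1 keeps the inequalities
  -- because $b\ge 0$.
  refine ⟨fun j => A.det.sign * A.cramer B j, fun i => ?_, ?_⟩
  · have habs : (1 : ℚ) ≤ (|A.det| : ℤ) := by exact_mod_cast Int.one_le_abs hdet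
    have h1 : ((a i ⬝ᵥ fun j => A.det.sign * A.cramer B j : ℤ) : ℚ) =
        ((|A.det| : ℤ) : ℚ) * ((fun j => (a i j : ℚ)) ⬝ᵥ x) := by
      rw [cast_dot, ← Int.sign_mul_self_eq_abs A.det]
      rw [← smul_eq_mul, ← dotProduct_smul]
      congr 1
      ext j
      simp only [Int.cast_mul, hcr, Pi.smul_apply, smul_eq_mul, mul_assoc]
    have h2 : (b i : ℚ) ≤ ((a i ⬝ᵥ fun j => A.det.sign * A.cramer B j : ℤ) : ℚ) := by
      rw [h1]
      have hb : (0 : ℚ) ≤ b i := by exact_mod_cast hb0 i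
      nlinarith [hx i]
    exact_mod_cast h2
  · choose p q p' q' h using fun j => hrow (s j)
    refine le_trans ?_ (abs_cramer_zero_le A B
      (fun i => abs_le.2 ⟨by linarith [hb0 (s i)], hb1 _⟩) p q p' q' h)
    refine (le_abs_self _).trans ?_
    rw [abs_mul]
    refine mul_le_of_le_one_left (abs_nonneg _) ?_
    rcases Int.sign_trichotomy A.det with h | h | h <;> simp [h]

/-- Every integer point `(x, K)` can be replaced by one with small last coordinate that still
satisfies all inequalities of a certain shape that `(x, K)` satisfies. -/
lemma exists_small_solution {σ : Type*} [Fintype σ] (x : σ → ℤ) (K : ℤ) (hx : ∀ i, 0 ≤ x i)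
    (hK : 0 ≤ K) :
    ∃ (z : σ → ℤ) (K' : ℤ), K' ≤ (Fintype.card σ + 1) * 2 ^ Fintype.card σ ∧
      ∀ (c : SignType) (b : Fin 2) (p q p' q' : Option σ),
        (b : ℤ) ≤ c * K + ((p.elim 0 x - q.elim 0 x) + (p'.elim 0 x - q'.elim 0 x)) →
        (b : ℤ) ≤ c * K' + ((p.elim 0 z - q.elim 0 z) + (p'.elim 0 z - q'.elim 0 z)) := by
  set m := Fintype.card σ
  let e : σ ≃ Fin m := Fintype.equivFin σ
  let R := SignType × Fin 2 × Option σ × Option σ × Option σ × Option σ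
  let row : R → Fin (m + 1) → ℤ := fun r => Fin.cons (r.1 : ℤ) fun j =>
    (optionBasis (r.2.2.1.map e) j - optionBasis (r.2.2.2.1.map e) j) +
      (optionBasis (r.2.2.2.2.1.map e) j - optionBasis (r.2.2.2.2.2.map e) j)
  have hdot (o : Option σ) (y : Fin m → ℤ) :
      ∑ j, optionBasis (o.map e) j * y j = o.elim 0 (y ∘ e) := by
    cases o <;> simp [optionBasis]
  have hrow (r : R) (y : Fin (m + 1) → ℤ) : row r ⬝ᵥ y = r.1 * y 0 +
      ((r.2.2.1.elim 0 fun i => y (e i).succ) - (r.2.2.2.1.elim 0 fun i => y (e i).succ) +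
      ((r.2.2.2.2.1.elim 0 fun i => y (e i).succ) -
        (r.2.2.2.2.2.elim 0 fun i => y (e i).succ))) := by
    have := fun o => hdot o (fun j => y j.succ)
    simp only [Function.comp_def] at this
    simp [row, dotProduct, Fin.sum_univ_succ, add_mul, sub_mul, Finset.sum_add_distrib,
      Finset.sum_sub_distrib, this]
  let y : Fin (m + 1) → ℤ := Fin.cons K (x ∘ e.symm)
  have hy (r : R) : row r ⬝ᵥ y = r.1 * K + ((r.2.2.1.elim 0 x - r.2.2.2.1.elim 0 x) +
      (r.2.2.2.2.1.elim 0 x - r.2.2.2.2.2.elim 0 x)) := by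
    rw [hrow]
    simp [y]
  -- The system consists of all inequalities of the given shape that hold at `(x, K)`.
  -- Non-negativity of `x` and `K` supplies the unit rows.
  obtain ⟨z, hz, hz0⟩ := exists_integer_solution
    (ι := {r : R // ((r.2.1 : ℕ) : ℤ) ≤ row r ⬝ᵥ y}) (m := m)
    (fun r => row r) (fun r => ((r.1.2.1 : ℕ) : ℤ)) (fun r => by positivity)
    (fun r => by have := r.1.2.1.2; omega)
    (fun r => ⟨_, _, _, _, fun j => by simp only [row, Fin.cons_succ]; rfl⟩)
    (fun j => by
      refine Fin.cases ?_ (fun j => ?_) j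
      · refine ⟨⟨(1, 0, none, none, none, none), by rw [hy]; simpa using hK⟩, ?_⟩
        ext j
        refine Fin.cases ?_ (fun j => ?_) j <;> simp [row]
      · refine ⟨⟨(0, 0, some (e.symm j), none, none, none), by rw [hy]; simpa using hx _⟩, ?_⟩
        ext i
        refine Fin.cases ?_ (fun i => ?_) i
        · simp [row]
        · simp [row, optionBasis, Pi.single_apply, eq_comm])
    ⟨y, fun r => r.2⟩
  refine ⟨fun i => z (e i).succ, z 0, hz0, fun c b p q p' q' h => ?_⟩
  exact (hz ⟨(c, b, p, q, p', q'), by rw [hy]; exact h⟩).trans_eq (hrow _ z)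


/-! ### Metric properties of trees. -/

namespace SimpleGraph

variable {W : Type*} {T : SimpleGraph W}

lemma notMem_edges_of_length_eq_dist {x a b : W} (p : T.Walk x a)
    (hp : p.length = T.dist x a) (h : T.dist x b = T.dist x a + 1) : s(a, b) ∉ p.edges := by
  classical
  intro he
  have hb := p.snd_mem_support_of_mem_edges he
  have h1 := T.dist_le (p.takeUntil b hb)
  have h2 := p.length_takeUntil_le_length hb
  omega

/-- In a tree, the distance between vertices on different sides of an edge is the sum of
distances to one end of the edge. -/
lemma IsTree.dist_eq_of_separated (hT : T.IsTree) {x y a b : W} (hab : T.Adj a b)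
    (hx : T.dist x b = T.dist x a + 1) (hy : T.dist y a = T.dist y b + 1) :
    T.dist x y = T.dist x a + T.dist y a := by
  classical
  obtain ⟨p, hp⟩ := hT.connected.exists_walk_length_eq_dist x a
  obtain ⟨q, hq⟩ := hT.connected.exists_walk_length_eq_dist y b
  obtain ⟨r, hr⟩ := hT.connected.exists_walk_length_eq_dist x y
  have hbr : T.IsBridge s(a, b) := isAcyclic_iff_forall_adj_isBridge.1 hT.isAcyclic hab
  -- The walk from `a` to `b` through `x` and `y` must cross the bridge, and only its middle part
  -- `r` can. So `a` lies on a shortest walk from `x` to `y`.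
  have hmem := isBridge_iff_forall_walk_mem_edges.1 hbr ((p.reverse.append r).append q)
  have hp' := notMem_edges_of_length_eq_dist p hp hx
  have hq' : s(a, b) ∉ q.edges := by
    rw [Sym2.eq_swap]
    exact notMem_edges_of_length_eq_dist q hq hy
  simp only [Walk.edges_append, Walk.edges_reverse, List.mem_append, List.mem_reverse, hp', hq',
    or_false, false_or] at hmem
  have ha := r.fst_mem_support_of_mem_edges hmem
  have h1 := T.dist_le (r.takeUntil a ha)
  have h2 := T.dist_le (r.dropUntil a ha)
  have h3 := congrArg Walk.length (r.take_spec ha)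
  rw [Walk.length_append] at h3
  have h4 := hT.connected.dist_triangle (u := x) (v := a) (w := y)
  rw [T.dist_comm (u := a) (v := y)] at *
  omega

/-- The four-point condition. -/
lemma IsTree.four_point (hT : T.IsTree) (r w v u : W) :
    T.dist u v + T.dist r w ≤ max (T.dist r v + T.dist u w) (T.dist r u + T.dist w v) := by
  obtain ⟨p, -⟩ := hT.connected.exists_walk_length_eq_dist u v
  induction p with
  | @nil u =>
    have := hT.connected.dist_triangle (u := r) (v := u) (w := w)
    rw [T.dist_comm (u := u)] at this
    simpa [T.dist_comm] using this
  | @cons u u' v huu' p ih =>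
    -- Each of `r`, `w`, `v` lies on one side of the edge `uu'`. Vertices on opposite sides have
    -- exact distance formulas, which complement the induction hypothesis.
    have hr := hT.dist_eq_dist_add_one_of_adj r huu'
    have hw := hT.dist_eq_dist_add_one_of_adj w huu'
    have hv := hT.dist_eq_dist_add_one_of_adj v huu'
    have c1 := T.dist_comm (u := u) (v := v)
    have c2 := T.dist_comm (u := u) (v := w)
    have c3 := T.dist_comm (u := u') (v := v)
    have c4 := T.dist_comm (u := u') (v := w)
    have c5 := T.dist_comm (u := r) (v := w)
    have c6 := T.dist_comm (u := v) (v := r)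
    have c7 := T.dist_comm (u := v) (v := w)
    have tri := fun x y => hT.connected.dist_triangle (u := x) (v := u) (w := y)
    have t1 := tri r w
    have t2 := tri v w
    have t3 := tri v r
    have sep := fun (x y : W) h1 h2 => hT.dist_eq_of_separated (x := x) (y := y) huu' h1 h2
    have sep' := fun (x y : W) h1 h2 => hT.dist_eq_of_separated (x := x) (y := y) huu'.symm h1 h2
    have s1 := sep r v
    have s2 := sep w v
    have s3 := sep r w
    have s4 := sep w r
    have s5 := sep' r v
    have s6 := sep' w v
    rcases hr with hr | hr <;> rcases hw with hw | hw <;> rcases hv with hv | hv <;> omega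

/-- The triangle inequality is strict at a leaf. -/
lemma IsTree.dist_add_two_le_of_isLeaf (hT : T.IsTree) {x y w : W} (hw : LeafRank.IsLeaf T w)
    (hx : x ≠ w) (hy : y ≠ w) : T.dist x y + 2 ≤ T.dist x w + T.dist y w := by
  obtain ⟨c, hc⟩ := Set.ncard_eq_one.1 hw
  have key : ∀ z, z ≠ w → T.dist z c + 1 ≤ T.dist z w := by
    intro z hz
    obtain ⟨p, hp⟩ := hT.connected.exists_walk_length_eq_dist w z
    cases p with
    | nil => exact (hz rfl).elim
    | @cons _ c' _ h p =>
      have : c' = c := by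
        have : c' ∈ T.neighborSet w := h
        simpa [hc] using this
      subst this
      have h1 := T.dist_le p
      rw [Walk.length_cons] at hp
      rw [T.dist_comm (u := z), T.dist_comm (u := z)]
      omega
  have h1 := key x hx
  have h2 := key y hy
  have h3 := hT.connected.dist_triangle (u := x) (v := c) (w := y)
  rw [T.dist_comm (u := c)] at h3
  omega

/-- A graph in which adjacent vertices have different levels and every vertex has at most one
neighbour of smaller level is acyclic. -/
lemma isAcyclic_of_level (ℓ : W → ℕ) (hne : ∀ x y, T.Adj x y → ℓ x ≠ ℓ y)
    (huniq : ∀ x y z, T.Adj x y → T.Adj x z → ℓ y < ℓ x → ℓ z < ℓ x → y = z) :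
    T.IsAcyclic := by
  classical
  intro v c hc
  obtain ⟨x, hx, hmax⟩ := Finset.exists_max_image c.support.toFinset ℓ ⟨v, by simp⟩
  simp only [List.mem_toFinset] at hx hmax
  have hc' := hc.rotate hx
  have hmem : ∀ y ∈ (c.rotate x hx).support, ℓ y ≤ ℓ x := fun y hy =>
    hmax y (by simpa using hy)
  have hnil : ¬ (c.rotate x hx).Nil := hc'.not_nil
  have a1 := (c.rotate x hx).adj_snd hnil
  have a2 := ((c.rotate x hx).adj_penultimate hnil).symm
  -- Both cycle neighbours of a vertex of maximal level have smaller level, so they would coincide.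
  exact hc'.snd_ne_penultimate <| huniq x _ _ a1 a2
    ((hmem _ (Walk.getVert_mem_support _ _)).lt_of_ne (hne _ _ a1).symm)
    ((hmem _ (Walk.getVert_mem_support _ _)).lt_of_ne (hne _ _ a2).symm)

lemma Connected.sub_le_dist (hT : T.Connected) (φ : W → ℤ)
    (hφ : ∀ x y, T.Adj x y → φ y ≤ φ x + 1) (x y : W) : φ y - φ x ≤ T.dist x y := by
  obtain ⟨p, hp⟩ := hT.exists_walk_length_eq_dist x y
  rw [← hp]
  clear hp
  induction p with
  | nil => simp
  | cons h p ih =>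
    have := hφ _ _ h
    rw [Walk.length_cons]
    push_cast
    omega

end SimpleGraph


/-! ### Trees with prescribed branching depths. -/

/-- `g u v` is the depth at which the branches of the leaves `u` and `v` of a rooted tree part,
and `g u u` the depth of the leaf `u`. -/
structure IsBranchDepth {ι : Type} (g : ι → ι → ℕ) : Prop where
  symm : ∀ u v, g u v = g v u
  ultra : ∀ u v w, min (g u v) (g v w) ≤ g u w
  lt_self : ∀ u v, u ≠ v → g u v < g u u
  pos : ∀ u v, 0 < g u v

namespace IsBranchDepth

variable {ι : Type} {g : ι → ι → ℕ}

lemma le_self (hg : IsBranchDepth g) (u v : ι) : g u v ≤ g u u := by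
  have := hg.ultra u v u
  rwa [hg.symm v u, min_self] at this

lemma le_self' (hg : IsBranchDepth g) (u v : ι) : g u v ≤ g v v :=
  hg.symm u v ▸ hg.le_self v u

/-- Points of the branches towards `u` and `v` are identified up to depth `g u v`. -/
def setoid (hg : IsBranchDepth g) : Setoid (Σ u, Fin (g u u + 1)) where
  r x y := x.2.val = y.2.val ∧ x.2.val ≤ g x.1 y.1
  iseqv := by
    refine ⟨fun x => ⟨rfl, by omega⟩, fun {x y} h => ⟨h.1.symm, ?_⟩, fun {x y z} h h' =>
      ⟨h.1.trans h'.1, ?_⟩⟩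
    · exact (h.1.symm.trans_le h.2).trans_eq (hg.symm _ _)
    · exact le_trans (le_min h.2 (h.1 ▸ h'.2)) (hg.ultra _ y.1 _)

/-- The vertices of the tree with prescribed branching depths. -/
def Vertex (hg : IsBranchDepth g) : Type := Quotient hg.setoid

instance [Finite ι] (hg : IsBranchDepth g) : Finite hg.Vertex :=
  inferInstanceAs (Finite (Quotient hg.setoid))

/-- The vertex at depth `i` on the branch towards `u`. -/
def node (hg : IsBranchDepth g) (u : ι) (i : ℕ) (hi : i ≤ g u u) : hg.Vertex :=
  Quotient.mk hg.setoid ⟨u, i, Nat.lt_succ_of_le hi⟩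

lemma node_eq_iff (hg : IsBranchDepth g) {u v : ι} {i j : ℕ} (hi : i ≤ g u u) (hj : j ≤ g v v) :
    hg.node u i hi = hg.node v j hj ↔ i = j ∧ i ≤ g u v :=
  Quotient.eq (r := hg.setoid)

lemma exists_eq_node (hg : IsBranchDepth g) (x : hg.Vertex) : ∃ u i hi, x = hg.node u i hi := by
  induction x using Quotient.inductionOn with
  | h x => exact ⟨x.1, x.2, Nat.le_of_lt_succ x.2.2, rfl⟩

/-- The depth of a vertex. -/
def depth (hg : IsBranchDepth g) : hg.Vertex → ℕ :=
  Quotient.lift (fun x => x.2.val) fun _ _ h => h.1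

@[simp] lemma depth_node (hg : IsBranchDepth g) (u : ι) (i : ℕ) (hi : i ≤ g u u) :
    hg.depth (hg.node u i hi) = i := rfl

/-- The distance to the leaf `u`. -/
def distLeaf (hg : IsBranchDepth g) (u : ι) : hg.Vertex → ℤ :=
  Quotient.lift (fun x => (x.2.val : ℤ) + g u u - 2 * min (x.2.val : ℤ) (g u x.1)) fun x y h => by
    have h1 := h.1
    have h2 := h.2
    have h3 := hg.ultra u x.1 y.1
    have h4 := hg.ultra u y.1 x.1
    rw [hg.symm y.1 x.1] at h4
    change (x.2.val : ℤ) + g u u - 2 * min (x.2.val : ℤ) (g u x.1) =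
      (y.2.val : ℤ) + g u u - 2 * min (y.2.val : ℤ) (g u y.1)
    omega

@[simp] lemma distLeaf_node (hg : IsBranchDepth g) (u v : ι) (i : ℕ) (hi : i ≤ g v v) :
    hg.distLeaf u (hg.node v i hi) = i + g u u - 2 * min (i : ℤ) (g u v) := rfl

/-- The tree with prescribed branching depths. -/
def tree (hg : IsBranchDepth g) : SimpleGraph hg.Vertex where
  Adj x y := ∃ u i, ∃ h : i + 1 ≤ g u u,
    (x = hg.node u i (by omega) ∧ y = hg.node u (i + 1) h) ∨
    (y = hg.node u i (by omega) ∧ x = hg.node u (i + 1) h)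
  symm := ⟨fun x y ⟨u, i, h, h'⟩ => ⟨u, i, h, h'.symm⟩⟩
  loopless := ⟨by
    rintro x ⟨u, i, h, ⟨h1, h2⟩ | ⟨h1, h2⟩⟩ <;>
    · have := congrArg hg.depth (h1.symm.trans h2)
      simp at this⟩

lemma adj_node_succ (hg : IsBranchDepth g) (u : ι) (i : ℕ) (h : i + 1 ≤ g u u) :
    hg.tree.Adj (hg.node u i (by omega)) (hg.node u (i + 1) h) :=
  ⟨u, i, h, Or.inl ⟨rfl, rfl⟩⟩

lemma exists_of_adj_of_depth_lt (hg : IsBranchDepth g) {x y : hg.Vertex} (h : hg.tree.Adj x y)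
    (hlt : hg.depth y < hg.depth x) : ∃ u i, ∃ h : i + 1 ≤ g u u,
      y = hg.node u i (by omega) ∧ x = hg.node u (i + 1) h := by
  obtain ⟨u, i, h, ⟨rfl, rfl⟩ | ⟨h1, h2⟩⟩ := h
  · simp at hlt
  · exact ⟨u, i, h, h1, h2⟩

lemma exists_walk (hg : IsBranchDepth g) (u : ι) (i d : ℕ) (h : i + d ≤ g u u) :
    ∃ p : hg.tree.Walk (hg.node u i (by omega)) (hg.node u (i + d) h), p.length = d := by
  induction d with
  | zero => exact ⟨SimpleGraph.Walk.nil, rfl⟩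
  | succ d ih =>
    obtain ⟨p, hp⟩ := ih (by omega)
    exact ⟨p.concat (hg.adj_node_succ u (i + d) h), by simp [hp]⟩

lemma exists_walk_leaf (hg : IsBranchDepth g) (u : ι) (i : ℕ) (h : i ≤ g u u) :
    ∃ p : hg.tree.Walk (hg.node u i h) (hg.node u (g u u) le_rfl), p.length = g u u - i := by
  obtain ⟨p, hp⟩ := hg.exists_walk u i (g u u - i) (by omega)
  exact ⟨p.copy rfl (by congr 1; omega), by simpa using hp⟩

lemma connected_tree [Nonempty ι] (hg : IsBranchDepth g) : hg.tree.Connected := by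
  obtain ⟨r⟩ := ‹Nonempty ι›
  rw [SimpleGraph.connected_iff_exists_forall_reachable]
  refine ⟨hg.node r 0 (by omega), fun x => ?_⟩
  obtain ⟨u, i, hi, rfl⟩ := hg.exists_eq_node x
  obtain ⟨p, -⟩ := hg.exists_walk u 0 i (by omega)
  exact ⟨p.copy ((hg.node_eq_iff _ _).2 ⟨rfl, by omega⟩) (by congr 1; omega)⟩

lemma isTree_tree [Nonempty ι] (hg : IsBranchDepth g) : hg.tree.IsTree := by
  refine ⟨hg.connected_tree, SimpleGraph.isAcyclic_of_level hg.depth ?_ ?_⟩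
  · rintro _ _ ⟨u, i, h, ⟨rfl, rfl⟩ | ⟨rfl, rfl⟩⟩ <;> simp
  · intro x y z hy hz hy' hz'
    obtain ⟨u, i, h, hy, hx⟩ := hg.exists_of_adj_of_depth_lt hy hy'
    obtain ⟨v, j, h', hz, hx'⟩ := hg.exists_of_adj_of_depth_lt hz hz'
    rw [hx, node_eq_iff] at hx'
    rw [hy, hz, node_eq_iff]
    omega

lemma distLeaf_le_of_adj (hg : IsBranchDepth g) (u : ι) (x y : hg.Vertex) (h : hg.tree.Adj x y) :
    hg.distLeaf u y ≤ hg.distLeaf u x + 1 := by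
  obtain ⟨v, i, h, ⟨rfl, rfl⟩ | ⟨rfl, rfl⟩⟩ := h <;> simp only [distLeaf_node] <;> push_cast <;>
    omega

/-- The walk through the branching point gives the upper bound. The lower bound holds because
`distLeaf` grows by at most 1 along each edge. -/
lemma dist_leaf_leaf [Nonempty ι] (hg : IsBranchDepth g) (u v : ι) :
    hg.tree.dist (hg.node u (g u u) le_rfl) (hg.node v (g v v) le_rfl) =
      (g u u - g u v) + (g v v - g u v) := by
  have h1 := hg.le_self u v
  have h2 := hg.le_self' u v
  refine le_antisymm ?_ ?_
  · obtain ⟨p, hp⟩ := hg.exists_walk_leaf u (g u v) h1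
    obtain ⟨q, hq⟩ := hg.exists_walk_leaf v (g u v) h2
    have he : hg.node v (g u v) h2 = hg.node u (g u v) h1 :=
      (hg.node_eq_iff _ _).2 ⟨rfl, (hg.symm u v).le⟩
    have := hg.tree.dist_le (p.reverse.append (q.copy he rfl))
    simpa [hp, hq] using this
  · have := hg.connected_tree.sub_le_dist (hg.distLeaf u) (hg.distLeaf_le_of_adj u)
      (hg.node u (g u u) le_rfl) (hg.node v (g v v) le_rfl)
    simp only [distLeaf_node] at this
    omega

lemma dist_root_leaf [Nonempty ι] (hg : IsBranchDepth g) (r u : ι) :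
    hg.tree.dist (hg.node r 0 (Nat.zero_le _)) (hg.node u (g u u) le_rfl) = g u u := by
  refine le_antisymm ?_ ?_
  · obtain ⟨p, hp⟩ := hg.exists_walk_leaf u 0 (Nat.zero_le _)
    have := hg.tree.dist_le (p.copy ((hg.node_eq_iff _ (Nat.zero_le (g r r))).2
      ⟨rfl, Nat.zero_le _⟩) rfl)
    simpa [hp] using this
  · have := hg.connected_tree.sub_le_dist (hg.distLeaf u) (hg.distLeaf_le_of_adj u)
      (hg.node u (g u u) le_rfl) (hg.node r 0 (Nat.zero_le _))
    rw [SimpleGraph.dist_comm]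
    simp only [distLeaf_node] at this
    omega

/-- Positivity of `g` makes all branches share their first edge. -/
lemma isLeaf_root (hg : IsBranchDepth g) (r : ι) :
    LeafRank.IsLeaf hg.tree (hg.node r 0 (Nat.zero_le _)) := by
  refine Set.ncard_eq_one.2 ⟨hg.node r 1 (hg.pos r r), ?_⟩
  ext y
  simp only [SimpleGraph.mem_neighborSet, Set.mem_singleton_iff]
  constructor
  · rintro ⟨u, i, h, ⟨h1, rfl⟩ | ⟨-, h1⟩⟩
    · rw [node_eq_iff] at h1 ⊢
      have := hg.pos u r
      omega
    · rw [node_eq_iff] at h1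
      omega
  · rintro rfl
    exact hg.adj_node_succ r 0 _

/-- By `lt_self`, the end of a branch lies on no other branch. -/
lemma isLeaf_leaf (hg : IsBranchDepth g) (u : ι) :
    LeafRank.IsLeaf hg.tree (hg.node u (g u u) le_rfl) := by
  have h0 := hg.pos u u
  refine Set.ncard_eq_one.2 ⟨hg.node u (g u u - 1) (by omega), ?_⟩
  ext y
  simp only [SimpleGraph.mem_neighborSet, Set.mem_singleton_iff]
  constructor
  · rintro ⟨v, i, h, ⟨h1, rfl⟩ | ⟨rfl, h1⟩⟩
    · rw [node_eq_iff] at h1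
      by_cases huv : u = v
      · subst huv
        omega
      · have := hg.lt_self u v huv
        omega
    · rw [node_eq_iff] at h1 ⊢
      rw [hg.symm v u]
      omega
  · rintro rfl
    have := hg.adj_node_succ u (g u u - 1) (by omega)
    convert this.symm using 2
    omega

lemma not_isLeaf_of_lt (hg : IsBranchDepth g) (u : ι) (i : ℕ) (h0 : 0 < i) (h1 : i < g u u) :
    ¬ LeafRank.IsLeaf hg.tree (hg.node u i h1.le) := by
  intro h
  obtain ⟨c, hc⟩ := Set.ncard_eq_one.1 h
  have a1 : hg.node u (i + 1) h1 ∈ hg.tree.neighborSet (hg.node u i h1.le) :=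
    hg.adj_node_succ u i h1
  obtain ⟨j, rfl⟩ : ∃ j, i = j + 1 := ⟨i - 1, by omega⟩
  have a2 : hg.node u j (by omega) ∈ hg.tree.neighborSet (hg.node u (j + 1) h1.le) :=
    (hg.adj_node_succ u j _).symm
  rw [hc, Set.mem_singleton_iff] at a1 a2
  have := (hg.node_eq_iff _ _).1 (a1.trans a2.symm)
  omega

/-- Branching depths are realized by a tree with an additional leaf as its root. -/
lemma exists_tree [Finite ι] [Nonempty ι] (hg : IsBranchDepth g) :
    ∃ (W : Type) (_ : Finite W) (T : SimpleGraph W) (f : Option ι ↪ W), T.IsTree ∧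
      {w | LeafRank.IsLeaf T w} = Set.range f ∧
      (∀ u, T.dist (f none) (f (some u)) = g u u) ∧
      ∀ u v, T.dist (f (some u)) (f (some v)) = (g u u - g u v) + (g v v - g u v) := by
  obtain ⟨r⟩ := id ‹Nonempty ι›
  let f : Option ι → hg.Vertex := fun o => o.elim (hg.node r 0 (Nat.zero_le _))
    fun u => hg.node u (g u u) le_rfl
  have hf : Function.Injective f := by
    rintro (_ | u) (_ | v) h
    · rfl
    · have := ((hg.node_eq_iff (Nat.zero_le _) le_rfl).1 h).1
      have := hg.pos v v
      omega
    · have := ((hg.node_eq_iff le_rfl (Nat.zero_le _)).1 h).1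
      have := hg.pos u u
      omega
    · by_contra hne
      have h1 := ((hg.node_eq_iff le_rfl le_rfl).1 h).2
      have h2 := hg.lt_self u v (fun h => hne (by rw [h]))
      omega
  refine ⟨hg.Vertex, inferInstance, hg.tree, ⟨f, hf⟩, hg.isTree_tree, ?_, hg.dist_root_leaf r,
    hg.dist_leaf_leaf⟩
  ext w
  constructor
  · intro hw
    obtain ⟨u, i, hi, rfl⟩ := hg.exists_eq_node w
    rcases Nat.eq_zero_or_pos i with rfl | h0
    · exact ⟨none, (hg.node_eq_iff (Nat.zero_le _) hi).2 ⟨rfl, Nat.zero_le _⟩⟩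
    · rcases hi.eq_or_lt with rfl | h1
      · exact ⟨some u, rfl⟩
      · exact (hg.not_isLeaf_of_lt u i h0 h1 hw).elim
  · rintro ⟨_ | u, rfl⟩
    · exact hg.isLeaf_root r
    · exact hg.isLeaf_leaf u

end IsBranchDepth


/-! ### Counting the values of an ultrametric. -/

/-- An ultrametric takes few values off the diagonal. -/
lemma card_image_offDiag_add_one_le {ι : Type*} [DecidableEq ι] (g : ι → ι → ℤ)
    (hsymm : ∀ u v, g u v = g v u) (hultra : ∀ u v w, min (g u v) (g v w) ≤ g u w)
    (X : Finset ι) (hX : X.Nonempty) :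
    (X.offDiag.image fun p => g p.1 p.2).card + 1 ≤ X.card := by
  induction hX using Finset.Nonempty.cons_induction with
  | singleton a => simp
  | cons a X ha hX ih =>
    obtain ⟨p, hp, hmax⟩ := X.exists_max_image (g a) hX
    have hsub : ((Finset.cons a X ha).offDiag.image fun q => g q.1 q.2) ⊆
        insert (g a p) (X.offDiag.image fun q => g q.1 q.2) := by
      -- A new point `a` adds at most the value `g a p` at its closest point `p`: if `g a u` is
      -- smaller, then it equals `g p u`.
      have key : ∀ u ∈ X, g a u ∈ insert (g a p) (X.offDiag.image fun q => g q.1 q.2) := by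
        intro u hu
        rcases (hmax u hu).eq_or_lt with h | h
        · simp [h]
        · have h1 := hultra a p u
          have h2 := hultra p a u
          rw [hsymm p a] at h2
          have h3 : g a u = g p u := by omega
          have hne : p ≠ u := by
            rintro rfl
            exact h.ne rfl
          exact Finset.mem_insert_of_mem (Finset.mem_image.2 ⟨(p, u), by simp [*], h3.symm⟩)
      intro y hy
      simp only [Finset.mem_image, Finset.mem_offDiag, Finset.mem_cons, Prod.exists] at hy
      obtain ⟨u, v, ⟨hu | hu, hv | hv, hne⟩, rfl⟩ := hy
      · exact (hne (hu.trans hv.symm)).elim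
      · exact hu ▸ key v hv
      · rw [hv, hsymm u a]
        exact key u hu
      · exact Finset.mem_insert_of_mem (Finset.mem_image.2 ⟨(u, v), by simp [*], rfl⟩)
    have h1 := (Finset.card_le_card hsub).trans (Finset.card_insert_le _ _)
    rw [Finset.card_cons]
    omega

/-! ### Compressing a leaf root. -/

namespace LeafRank

lemma HasLeafRoot.comap {V V' : Type*} {G : SimpleGraph V} {k : ℕ} (h : HasLeafRoot G k)
    (e : V' ≃ V) : HasLeafRoot (G.comap e) k := by
  obtain ⟨W, hW, T, f, hT, hl, ha⟩ := h
  refine ⟨W, hW, T, e.toEmbedding.trans f, hT, ?_, fun u v huv => ?_⟩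
  · rw [hl]
    exact (EquivLike.range_comp f e).symm
  · exact ha _ _ (e.injective.ne huv)

lemma HasLeafRoot.exists_le_of_option {ι : Type} [Fintype ι] [Nonempty ι]
    {G : SimpleGraph (Option ι)} {k : ℕ} (h : HasLeafRoot G k) :
    ∃ k' ≤ 2 * Fintype.card ι * 2 ^ (2 * Fintype.card ι), HasLeafRoot G k' := by
  classical
  obtain ⟨W, -, T, f, hT, hl, ha⟩ := h
  have leaf : ∀ o, IsLeaf T (f o) := fun o => hl.symm.subset ⟨o, rfl⟩
  let d : Option ι → Option ι → ℤ := fun o o' => T.dist (f o) (f o')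
  have dsymm : ∀ o o', d o o' = d o' o := fun o o' => by simp only [d, T.dist_comm]
  have dleaf : ∀ a b c, a ≠ c → b ≠ c → d a b + 2 ≤ d a c + d b c := fun a b c hac hbc => by
    have := hT.dist_add_two_le_of_isLeaf (leaf c) (f.injective.ne hac) (f.injective.ne hbc)
    simp only [d]
    exact_mod_cast this
  have dpos : ∀ u, 1 ≤ d none (some u) := fun u => by
    have := hT.connected.pos_dist_of_ne (f.injective.ne (Option.some_ne_none u).symm)
    simp only [d]
    exact_mod_cast this
  -- Twice the branching depth. Doubling the leaf depths and the threshold as well avoids any parity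
  -- argument.
  let g₂ : ι → ι → ℤ := fun u v => d none (some u) + d none (some v) - d (some u) (some v)
  have gsymm : ∀ u v, g₂ u v = g₂ v u := fun u v => by
    simp only [g₂, dsymm (some u) (some v)]
    ring
  have gultra : ∀ u v w, min (g₂ u v) (g₂ v w) ≤ g₂ u w := fun u v w => by
    have := hT.four_point (f none) (f (some v)) (f (some w)) (f (some u))
    simp only [g₂, d]
    omega
  have gpos : ∀ u v, u ≠ v → 2 ≤ g₂ u v := fun u v huv => by
    have := dleaf (some u) (some v) none (by simp) (by simp)
    simp only [g₂, dsymm none]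
    omega
  have glt : ∀ u v, u ≠ v → g₂ u v + 2 ≤ 2 * d none (some u) := fun u v huv => by
    have := dleaf none (some v) (some u) (by simp) (by simpa using huv.symm)
    simp only [g₂, dsymm (some u) (some v)]
    omega
  let S : Finset ℤ := Finset.univ.offDiag.image fun p : ι × ι => g₂ p.1 p.2
  have hS : ∀ u v, u ≠ v → g₂ u v ∈ S := fun u v huv =>
    Finset.mem_image.2 ⟨(u, v), by simpa using huv, rfl⟩
  have hS0 : ∀ s ∈ S, 2 ≤ s := fun s hs => by
    simp only [S, Finset.mem_image, Finset.mem_offDiag, Prod.exists] at hs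
    obtain ⟨u, v, ⟨-, -, huv⟩, rfl⟩ := hs
    exact gpos u v huv
  have hcard : S.card + 1 ≤ Fintype.card ι :=
    card_image_offDiag_add_one_le g₂ gsymm gultra Finset.univ Finset.univ_nonempty
  obtain ⟨z, K, hK, hz⟩ := exists_small_solution (σ := ι ⊕ S)
    (Sum.elim (fun u => 2 * d none (some u)) fun s => s.1) (2 * k)
    (by rintro (u | s)
        · have := dpos u
          simp only [Sum.elim_inl]
          omega
        · have := hS0 s.1 s.2
          simp only [Sum.elim_inr]
          omega)
    (by positivity)
  let l : ι → ℤ := fun u => z (Sum.inl u)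
  -- The new branching depth for each old value. The default 0 is never used, as `η` is only
  -- evaluated on `S`.
  let η : ℤ → ℤ := fun s => if hs : s ∈ S then z (Sum.inr ⟨s, hs⟩) else 0
  have lz : ∀ u, z (Sum.inl u) = l u := fun _ => rfl
  have ηS : ∀ s (hs : s ∈ S), z (Sum.inr ⟨s, hs⟩) = η s := fun s hs => by simp [η, hs]
  have hK0 : 0 ≤ K := by simpa using hz 1 0 none none none none
  have hl1 : ∀ u, 1 ≤ l u := fun u => by
    have := hz 0 1 (some (Sum.inl u)) none none none
    have h1 := dpos u
    simp [lz] at this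
    omega
  have hη1 : ∀ s ∈ S, 1 ≤ η s := fun s hs => by
    have := hz 0 1 (some (Sum.inr ⟨s, hs⟩)) none none none
    have h1 := hS0 s hs
    simp [ηS] at this
    omega
  have hηmono : ∀ s ∈ S, ∀ t ∈ S, s ≤ t → η s ≤ η t := fun s hs t ht hst => by
    have := hz 0 0 (some (Sum.inr ⟨t, ht⟩)) (some (Sum.inr ⟨s, hs⟩)) none none
    simp [ηS] at this
    omega
  have hlt : ∀ u v, u ≠ v → η (g₂ u v) < l u := fun u v huv => by
    have := hz 0 1 (some (Sum.inl u)) (some (Sum.inr ⟨_, hS u v huv⟩)) none none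
    have h1 := glt u v huv
    simp [ηS, lz] at this
    omega
  -- Adjacency is a weak inequality with `b = 0`, non-adjacency the strict reverse one with `b = 1`.
  -- Both transfer, which gives the equivalence.
  have hroot : ∀ u, l u ≤ K ↔ d none (some u) ≤ k := fun u => by
    have h1 := hz 1 0 none (some (Sum.inl u)) none none
    have h2 := hz (-1) 1 (some (Sum.inl u)) none none none
    simp [lz] at h1 h2
    omega
  have hpair : ∀ u v, u ≠ v → (l u + l v - 2 * η (g₂ u v) ≤ K ↔ d (some u) (some v) ≤ k) :=
    fun u v huv => by
    let s : Option (ι ⊕ S) := some (Sum.inr ⟨_, hS u v huv⟩)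
    have h1 := hz 1 0 s (some (Sum.inl u)) s (some (Sum.inl v))
    have h2 := hz (-1) 1 (some (Sum.inl u)) s (some (Sum.inl v)) s
    simp [s, ηS, lz] at h1 h2
    have h3 : g₂ u v = d none (some u) + d none (some v) - d (some u) (some v) := rfl
    omega
  let γ : ι → ι → ℤ := fun u v => if u = v then l u else η (g₂ u v)
  have γself : ∀ u, γ u u = l u := fun u => by simp [γ]
  have γne : ∀ u v, u ≠ v → γ u v = η (g₂ u v) := fun u v huv => by simp [γ, huv]
  have γpos : ∀ u v, 1 ≤ γ u v := fun u v => by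
    by_cases huv : u = v
    · subst huv
      rw [γself]
      exact hl1 u
    · rw [γne u v huv]
      exact hη1 _ (hS u v huv)
  have γsymm : ∀ u v, γ u v = γ v u := fun u v => by
    by_cases huv : u = v
    · rw [huv]
    · rw [γne u v huv, γne v u (Ne.symm huv), gsymm]
  have γlt : ∀ u v, u ≠ v → γ u v < γ u u := fun u v huv => by
    rw [γne u v huv, γself]
    exact hlt u v huv
  have γultra : ∀ u v w, min (γ u v) (γ v w) ≤ γ u w := fun u v w => by
    by_cases huw : u = w
    · subst huw
      by_cases huv : u = v
      · subst huv
        simp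
      · exact (min_le_left _ _).trans (γlt u v huv).le
    · by_cases huv : u = v
      · subst huv
        exact min_le_right _ _
      · by_cases hvw : v = w
        · subst hvw
          exact min_le_left _ _
        · rw [γne u v huv, γne v w hvw, γne u w huw]
          have := gultra u v w
          -- Monotonicity of `η` carries the ultrametric inequality over.
          rcases min_le_iff.1 this with h | h
          · exact (min_le_left _ _).trans (hηmono _ (hS u v huv) _ (hS u w huw) h)
          · exact (min_le_right _ _).trans (hηmono _ (hS v w hvw) _ (hS u w huw) h)
  have hg : IsBranchDepth fun u v => (γ u v).toNat := by
    refine ⟨fun u v => by rw [γsymm], fun u v w => ?_, fun u v huv => ?_, fun u v => ?_⟩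
    · have := γultra u v w
      omega
    · have := γlt u v huv
      have := γpos u v
      omega
    · have := γpos u v
      omega
  obtain ⟨W', hW', T', f', hT', hl', hr', hp'⟩ := hg.exists_tree
  refine ⟨K.toNat, ?_, W', hW', T', f', hT', hl', ?_⟩
  · have hσ : Fintype.card (ι ⊕ S) + 1 ≤ 2 * Fintype.card ι := by
      simp only [Fintype.card_sum, Fintype.card_coe]
      omega
    rw [Int.toNat_le]
    refine hK.trans ?_
    have : (Fintype.card (ι ⊕ S) + 1) * 2 ^ Fintype.card (ι ⊕ S) ≤
        2 * Fintype.card ι * 2 ^ (2 * Fintype.card ι) :=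
      Nat.mul_le_mul hσ (Nat.pow_le_pow_right two_pos (by omega))
    exact_mod_cast this
  · have hroot' : ∀ u, G.Adj none (some u) ↔ T'.dist (f' none) (f' (some u)) ≤ K.toNat := by
      intro u
      have h1 := hroot u
      have h2 := hl1 u
      rw [ha _ _ (by simp), hr', γself]
      simp only [d] at h1
      omega
    rintro (_ | u) (_ | v) huv
    · exact (huv rfl).elim
    · exact hroot' v
    · rw [G.adj_comm, T'.dist_comm]
      exact hroot' u
    · have huv' : u ≠ v := fun h => huv (by rw [h])
      have h1 := hpair u v huv'
      have h2 := γlt u v huv'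
      have h3 := γlt v u huv'.symm
      have h4 := γpos u v
      rw [γsymm v u] at h3
      rw [← γne u v huv', ← γself, ← γself v] at h1
      rw [ha _ _ huv, hp']
      simp only [d] at h1
      omega

lemma HasLeafRoot.exists_le {V : Type*} [Fintype V] {G : SimpleGraph V} {k : ℕ}
    (h : HasLeafRoot G k) :
    ∃ k' ≤ 2 * Fintype.card V * 2 ^ (2 * Fintype.card V), HasLeafRoot G k' := by
  rcases le_or_gt (Fintype.card V) 1 with h1 | h1
  -- Without two distinct vertices the threshold is irrelevant, so the same tree works with 0.
  · have := Fintype.card_le_one_iff_subsingleton.1 h1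
    obtain ⟨W, hW, T, f, hT, hl, -⟩ := h
    exact ⟨0, Nat.zero_le _, W, hW, T, f, hT, hl, fun u v huv => (huv (Subsingleton.elim _ _)).elim⟩
  · obtain ⟨N, hN⟩ : ∃ N, Fintype.card V = N + 1 + 1 := ⟨Fintype.card V - 2, by omega⟩
    let e : Option (Fin (N + 1)) ≃ V := Fintype.equivOfCardEq (by simp [hN])
    obtain ⟨k', hk', h'⟩ := (h.comap e).exists_le_of_option
    refine ⟨k', hk'.trans ?_, ?_⟩
    · rw [Fintype.card_fin, hN]
      exact Nat.mul_le_mul (by omega) (Nat.pow_le_pow_right two_pos (by omega))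
    · have := h'.comap e.symm
      rwa [SimpleGraph.comap_comap, ← Equiv.coe_trans, Equiv.symm_trans_self, Equiv.coe_refl,
        SimpleGraph.comap_id] at this

end LeafRank

theorem mainTheorem5 {V : Type*} [Fintype V] (G : SimpleGraph V) :
    LeafRank.leafRank G = ⊤ ∨
      LeafRank.leafRank G ≤
        ((2 * Fintype.card V * 2 ^ (2 * Fintype.card V) : ℕ) : ℕ∞) := by
  by_cases h : ∃ k, LeafRank.HasLeafRoot G k
  · obtain ⟨k, hk⟩ := h
    obtain ⟨k', hle, hk'⟩ := hk.exists_le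
    exact Or.inr (iInf₂_le_of_le k' hk' (by exact_mod_cast hle))
  · push Not at h
    exact Or.inl (by simp [LeafRank.leafRank, h])
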